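/- **Theorem 6.1.** Let $1\le M\le N$ be integers and put $\gamma=-M$, $q=N/M$ (so $q\gamma=-N$). *The $q$-$\gamma$ side.* For a real sequence $(k_l)_{l\ge1}$ with $k_l=0$ for all odd $l$, put $g(z)=\sum_{l\ge1}k_lz^{l-1}$ and $$m_{2k}=[z^0]\Big(\partial+2\gamma d+\big((q-1)\gamma-\tfrac12\big)d'+*_g\Big)^{2k-1}g(z)\qquad(k\ge1),$$ where $[z^0]$ takes the constant term and, on formal power series, $\partial=\frac{d}{dz}$; $d(1)=0$ and $d(z^n)=z^{n-1}$ for $n\ge1$; $d'(z^n)=0$ for $n$ even and $d'(z^n)=2z^{n-1}$ for $n$ odd; $*_g$ is multiplication by $g$. The $k_l$ are called $q$-$\gamma$ cumulants of the moments $m_{2k}$. The $q$-$\gamma$ convolution of $(m^a_{2k})_{k=1}^M$ and $(m^b_{2k})_{k=1}^M$ is the sequence $(m^c_{2k})_{k=1}^M$ whose $q$-$\gamma$ cumulants are $k_l^a+k_l^b$. *The rectangular finite side.* For $\vec a\in\mathbb R^M$ put $r_j=a_j^2$, $m'_k(\vec a)=\frac1M\sum_{j=1}^Mr_j^k$, and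 let $e_i$ be the $i$-th elementary symmetric polynomial. The $(M,N)$-rectangular finite R-transform of $\vec a$ is the unique polynomial $R(z)=\sum_{l=1}^{M}k^{N,M}_l(\vec a)z^l$ with $$R(z)\equiv-\frac1M\,z\frac{d}{dz}\ln\mathbb E\big[e^{-TzNM}\big]\pmod{z^{M+1}},\qquad \mathbb E[T^i]=\frac{i!\,(N-i)!}{N!}\,\frac{(M-i)!}{M!}\,e_i(r_1,\dots,r_M)\quad(0\le i\le M),$$ the expectation being expanded as a formal power series in $z$; its coefficients $k_l^{N,M}$ are the rectangular finite cumulants. For $\vec a,\vec b,\vec c\in\mathbb R^M$, $\vec c$ is an $(M,N)$-rectangular finite convolution of $\vec a$ and $\vec b$ if $$\prod_{j=1}^M(z-c_j^2)=\sum_{l=0}^M(-1)^l\Big(\sum_{i+j=l}\frac{(M-i)!(M-j)!}{M!(M-l)!}\,\frac{(N-i)!(N-j)!}{N!(N-l)!}\,e_i(a_1^2,\dots,a_M^2)\,e_j(b_1^2,\dots,b_M^2)\Big)z^{M-l}.$$ Then, with $q=N/M$ and $\gamma=-M$: 1. Every $(m_{2k})_{k=1}^M\in\mathbb R^M$ has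 $q$-$\gamma$ cumulants, and $k_1,\dots,k_{2M}$ are uniquely determined; the $q$-$\gamma$ convolution is a well-defined binary operation on $\mathbb R^M$ (the first $M$ even moments). 2. (Same moment-cumulant relation.) For every $\vec a\in\mathbb R^M$ and every real sequence $(k_l)_{l\ge1}$ with $k_l=0$ for odd $l$, the moments $m_{2k}$ defined by $(k_l)$ satisfy $m_{2k}=m'_k(\vec a)(-N)^k$ for $k=1,\dots,M$ if and only if $k^{N,M}_l(\vec a)=4^l\,\dfrac{k_{2l}}{2}\,\gamma^{l-1}$ for $l=1,\dots,M$. 3. (Same convolution.) For all $\vec a,\vec b,\vec c\in\mathbb R^M$, $\vec c$ is an $(M,N)$-rectangular finite convolution of $\vec a$ and $\vec b$ if and only if $\big(m'_k(\vec c)(-N)^k\big)_{k=1}^M$ is the $q$-$\gamma$ convolution of $\big(m'_k(\vec a)(-N)^k\big)_{k=1}^M$ and $\big(m'_k(\vec b)(-N)^k\big)_{k=1}^M$. -/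

import Mathlib

open scoped Nat PowerSeries

noncomputable section

namespace RectDuality

/-! ### The q-γ side: moments from cumulants

A sequence `κ : ℕ → ℝ` stands for the cumulants `(k_l)_{l ≥ 1}` (the value `κ 0` is never used), and
a sequence `m : ℕ → ℝ` stands for the even moments, `m k = m_{2k}` for `k ≥ 1` (the value `m 0` is
never used; the odd moments vanish). -/

/-- The operator `d` on `ℝ⟦z⟧`: `d 1 = 0` and `d z^n = z^(n-1)` for `n ≥ 1`. -/
def shiftOp (f : ℝ⟦X⟧) : ℝ⟦X⟧ :=
  PowerSeries.mk fun n => PowerSeries.coeff (n + 1) f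

/-- The operator `d'` on `ℝ⟦z⟧`: `d' z^n = 0` for `n` even and `d' z^n = 2 z^(n-1)` for `n` odd. -/
def oddShiftOp (f : ℝ⟦X⟧) : ℝ⟦X⟧ :=
  PowerSeries.mk fun n => if Odd (n + 1) then 2 * PowerSeries.coeff (n + 1) f else 0

/-- The series `g(z) = ∑_{l ≥ 1} k_l z^(l-1)`. -/
def cumulantSeries (κ : ℕ → ℝ) : ℝ⟦X⟧ :=
  PowerSeries.mk fun n => κ (n + 1)

/-- The operator `∂ + 2γ d + ((q-1)γ - 1/2) d' + *_g`, where `*_g` is multiplication by `g`. -/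
def qgOp (q γ : ℝ) (g f : ℝ⟦X⟧) : ℝ⟦X⟧ :=
  PowerSeries.derivative ℝ f + (2 * γ) • shiftOp f + ((q - 1) * γ - 1 / 2) • oddShiftOp f + g * f

/-- The map `T_{k → m}^{q,γ}`:
`m_{2k} = [z^0] (∂ + 2γ d + ((q-1)γ - 1/2) d' + *_g)^(2k-1) g`, for `k ≥ 1`. -/
def cumulantToMoment (q γ : ℝ) (κ : ℕ → ℝ) (k : ℕ) : ℝ :=
  PowerSeries.coeff 0 ((qgOp q γ (cumulantSeries κ))^[2 * k - 1] (cumulantSeries κ))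

/-- `κ` is a sequence of q-γ cumulants for the first `n` even moments `m 1, …, m n`: its odd terms
vanish and `T_{k → m}^{q,γ}` sends it to a sequence that starts with `m 1, …, m n`. -/
def IsQGammaCumulants (q γ : ℝ) (n : ℕ) (κ m : ℕ → ℝ) : Prop :=
  (∀ l, Odd l → κ l = 0) ∧ ∀ k, 1 ≤ k → k ≤ n → cumulantToMoment q γ κ k = m k

/-- `mc` is the q-γ convolution of `ma` and `mb`, as far as the first `n` even moments are
concerned: the q-γ cumulants of `mc` are the sums of those of `ma` and `mb`. -/
def IsQGammaConv (q γ : ℝ) (n : ℕ) (ma mb mc : ℕ → ℝ) : Prop :=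
  ∃ κa κb : ℕ → ℝ, IsQGammaCumulants q γ n κa ma ∧ IsQGammaCumulants q γ n κb mb ∧
    IsQGammaCumulants q γ n (fun l => κa l + κb l) mc

/-! ### The (M, N)-rectangular finite side -/

/-- `a_i = e_i(r_1, …, r_M)` with `r_j = a_j²`; it vanishes for `i > M`. -/
def sqEsymm {M : ℕ} (a : Fin M → ℝ) (i : ℕ) : ℝ :=
  ∑ s ∈ Finset.powersetCard i (Finset.univ : Finset (Fin M)), ∏ j ∈ s, a j ^ 2

/-- The finite moments `m'_k = (1/M) (r_1^k + … + r_M^k)` with `r_j = a_j²`. -/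
def finMoment {M : ℕ} (a : Fin M → ℝ) (k : ℕ) : ℝ :=
  (1 / (M : ℝ)) * ∑ j, (a j ^ 2) ^ k

/-- The polynomial `P_{M,N}(z)` attached to two `M`-tuples. -/
def rectConvPoly (M N : ℕ) (a b : Fin M → ℝ) : Polynomial ℝ :=
  ∑ l ∈ Finset.range (M + 1),
    Polynomial.C ((-1) ^ l * ∑ p ∈ Finset.HasAntidiagonal.antidiagonal l,
      ((((M - p.1)! * (M - p.2)! : ℕ) : ℝ) / ((M ! * (M - l)! : ℕ) : ℝ)) *
      ((((N - p.1)! * (N - p.2)! : ℕ) : ℝ) / ((N ! * (N - l)! : ℕ) : ℝ)) *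
      sqEsymm a p.1 * sqEsymm b p.2) * Polynomial.X ^ (M - l)

/-- `c` is the `(M, N)`-rectangular finite convolution of `a` and `b`: the numbers
`c_1², …, c_M²` are the roots, with multiplicity, of `P_{M,N}`. -/
def IsRectFiniteConv (M N : ℕ) (a b c : Fin M → ℝ) : Prop :=
  ∏ j, (Polynomial.X - Polynomial.C (c j ^ 2)) = rectConvPoly M N a b

/-- The moments `E[T^i] = (i! (N-i)! / N!) ((M-i)! / M!) e_i(r)`, `i ≤ M`, of the random variable
`T` behind the rectangular finite R-transform (the values for `i > M` are zero, and they play no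
role, see `isRectRTransform_iff`). -/
def rectTMoment (M N : ℕ) (a : Fin M → ℝ) (i : ℕ) : ℝ :=
  ((i ! * (N - i)! : ℕ) : ℝ) / (N ! : ℝ) * (((M - i)! : ℝ) / (M ! : ℝ)) * sqEsymm a i

/-- The formal Laplace transform `E[exp(-T s z)] = ∑_i E[T^i] (-s)^i z^i / i!`, as a power series
in `z`, of a random variable `T` with moments `τ`. -/
def formalLaplace (τ : ℕ → ℝ) (s : ℝ) : ℝ⟦X⟧ :=
  PowerSeries.mk fun i => τ i * (-s) ^ i / (i ! : ℝ)

/-- The series `(-1/M) z (d/dz) ln E[exp(-T z N M)]` for `T` with moments `τ`. -/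
def rectRSeries (M N : ℕ) (τ : ℕ → ℝ) : ℝ⟦X⟧ :=
  (-1 / (M : ℝ)) • (PowerSeries.X * PowerSeries.derivative ℝ
    (PowerSeries.logOf (formalLaplace τ ((N : ℝ) * (M : ℝ)))))

/-- `R` is the rectangular finite R-transform: a polynomial of degree at most `M` with
`R ≡ (-1/M) z (d/dz) ln E[exp(-T z N M)]  mod z^(M+1)`, whatever the moments of `T` of order
greater than `M` are. -/
def IsRectRTransform (M N : ℕ) (a : Fin M → ℝ) (R : Polynomial ℝ) : Prop :=
  R.natDegree ≤ M ∧ ∀ τ : ℕ → ℝ, (∀ i, i ≤ M → τ i = rectTMoment M N a i) →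
    (PowerSeries.X : ℝ⟦X⟧) ^ (M + 1) ∣ (R : ℝ⟦X⟧) - rectRSeries M N τ

/-- The rectangular finite R-transform. -/
def rectRTransform (M N : ℕ) (a : Fin M → ℝ) : Polynomial ℝ :=
  PowerSeries.trunc (M + 1) (rectRSeries M N (rectTMoment M N a))

/-- The rectangular finite cumulants `k^{N,M}_l`: the coefficients of the R-transform. -/
def rectCumulant (M N : ℕ) (a : Fin M → ℝ) (l : ℕ) : ℝ :=
  (rectRTransform M N a).coeff l

theorem rectTMoment_zero (M N : ℕ) (a : Fin M → ℝ) : rectTMoment M N a 0 = 1 := by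
  have h1 : (N ! : ℝ) ≠ 0 := by exact_mod_cast N.factorial_ne_zero
  have h2 : (M ! : ℝ) ≠ 0 := by exact_mod_cast M.factorial_ne_zero
  simp [rectTMoment, sqEsymm, h1, h2]

theorem derivative_logOf (f : ℝ⟦X⟧) (hf : PowerSeries.constantCoeff f = 1) :
    PowerSeries.derivative ℝ (PowerSeries.logOf f) * f = PowerSeries.derivative ℝ f := by
  have hs : PowerSeries.HasSubst (f - 1) :=
    PowerSeries.HasSubst.of_constantCoeff_zero' (by simp [hf])
  have hg : (PowerSeries.derivative ℝ (PowerSeries.log ℝ)) * (1 + PowerSeries.X) = 1 := by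
    rw [PowerSeries.deriv_log]
    ext n
    rw [mul_add, mul_one, map_add]
    cases n with
    | zero => simp
    | succ n =>
      rw [PowerSeries.coeff_succ_mul_X]
      simp [PowerSeries.coeff_one, pow_succ]
  have h1 : (PowerSeries.derivative ℝ (PowerSeries.log ℝ)).subst (f - 1) * f = 1 := by
    have := congrArg (PowerSeries.subst (f - 1)) hg
    rw [← PowerSeries.coe_substAlgHom hs, map_mul, map_add, map_one,
      PowerSeries.coe_substAlgHom hs, PowerSeries.subst_X hs] at this
    simpa using this
  rw [PowerSeries.logOf_eq, PowerSeries.derivative_subst hs]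
  have h2 : PowerSeries.derivative ℝ (f - 1) = PowerSeries.derivative ℝ f := by simp
  rw [h2, mul_right_comm, h1, one_mul]

/-- The R-transform exists, is unique, and does not depend on the moments of order above `M`. -/
theorem isRectRTransform_iff (M N : ℕ) (a : Fin M → ℝ) (R : Polynomial ℝ) :
    IsRectRTransform M N a R ↔ R = rectRTransform M N a := by
  have key : ∀ τ : ℕ → ℝ, (∀ i, i ≤ M → τ i = rectTMoment M N a i) →
      (PowerSeries.X : ℝ⟦X⟧) ^ (M + 1) ∣
        rectRSeries M N (rectTMoment M N a) - rectRSeries M N τ := by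
    intro τ hτ
    set s : ℝ := (N : ℝ) * (M : ℝ) with hs
    set F := formalLaplace (rectTMoment M N a) s with hF
    set G := formalLaplace τ s with hG
    have hF1 : PowerSeries.constantCoeff F = 1 := by
      rw [← PowerSeries.coeff_zero_eq_constantCoeff_apply]
      simp [hF, formalLaplace, rectTMoment_zero]
    have hG1 : PowerSeries.constantCoeff G = 1 := by
      rw [← PowerSeries.coeff_zero_eq_constantCoeff_apply]
      simp [hG, formalLaplace, hτ 0 (Nat.zero_le _), rectTMoment_zero]
    have hdF := derivative_logOf F hF1
    have hdG := derivative_logOf G hG1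
    have d1 : (PowerSeries.X : ℝ⟦X⟧) ^ (M + 1) ∣ F - G := by
      rw [PowerSeries.X_pow_dvd_iff]
      intro m hm
      simp [hF, hG, formalLaplace, hτ m (by omega)]
    have d2 : (PowerSeries.X : ℝ⟦X⟧) ^ (M + 1) ∣
        PowerSeries.X * (PowerSeries.derivative ℝ F - PowerSeries.derivative ℝ G) := by
      rw [pow_succ', ← map_sub]
      apply mul_dvd_mul_left
      rw [PowerSeries.X_pow_dvd_iff] at d1 ⊢
      intro m hm
      rw [PowerSeries.coeff_derivative, d1 (m + 1) (by omega), zero_mul]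
    have hFG : F⁻¹ * F = 1 := PowerSeries.inv_mul_cancel _ (by rw [hF1]; exact one_ne_zero)
    have e : PowerSeries.X * PowerSeries.derivative ℝ (PowerSeries.logOf F) -
        PowerSeries.X * PowerSeries.derivative ℝ (PowerSeries.logOf G) =
        F⁻¹ * (PowerSeries.X * (PowerSeries.derivative ℝ F - PowerSeries.derivative ℝ G)) -
        F⁻¹ * PowerSeries.X * PowerSeries.derivative ℝ (PowerSeries.logOf G) * (F - G) := by
      rw [← hdF, ← hdG]
      linear_combination (-(PowerSeries.X * PowerSeries.derivative ℝ (PowerSeries.logOf F) -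
        PowerSeries.X * PowerSeries.derivative ℝ (PowerSeries.logOf G))) * hFG
    have e2 : rectRSeries M N (rectTMoment M N a) - rectRSeries M N τ =
        (-1 / (M : ℝ)) • (PowerSeries.X * PowerSeries.derivative ℝ (PowerSeries.logOf F) -
        PowerSeries.X * PowerSeries.derivative ℝ (PowerSeries.logOf G)) := by
      simp only [rectRSeries, smul_sub, hF, hG, hs]
    rw [e2, e]
    exact dvd_smul_of_dvd _ (dvd_sub (d2.mul_left _) (d1.mul_left _))
  constructor
  · rintro ⟨hdeg, h⟩
    have h0 := h _ (fun _ _ => rfl)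
    rw [PowerSeries.X_pow_dvd_iff] at h0
    ext n
    rw [rectRTransform, PowerSeries.coeff_trunc]
    split_ifs with hn
    · have := h0 n hn
      rw [map_sub, Polynomial.coeff_coe] at this
      linarith
    · exact Polynomial.coeff_eq_zero_of_natDegree_lt (by omega)
  · rintro rfl
    refine ⟨Nat.lt_succ_iff.mp (PowerSeries.natDegree_trunc_lt _ _), fun τ hτ => ?_⟩
    have h1 : (PowerSeries.X : ℝ⟦X⟧) ^ (M + 1) ∣
        (rectRTransform M N a : ℝ⟦X⟧) - rectRSeries M N (rectTMoment M N a) := by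
      rw [PowerSeries.X_pow_dvd_iff]
      intro m hm
      rw [map_sub, Polynomial.coeff_coe, rectRTransform, PowerSeries.coeff_trunc, if_pos hm,
        sub_self]
    have := dvd_add h1 (key τ hτ)
    rwa [sub_add_sub_cancel] at this

/-! ### The identification of moments -/

/-- The even moments `m_{2k} := m'_k (-N)^k` that are identified with the finite moments. -/
def dualMoment {M : ℕ} (N : ℕ) (a : Fin M → ℝ) (k : ℕ) : ℝ :=
  finMoment a k * (-(N : ℝ)) ^ k

end RectDuality

end

/-! Everything is compared through exponential series. Put `G = exp (∑ k_l z^l / l)`, which is even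
because odd cumulants vanish; let `c_n` be its coefficient at `z^(2n)`. Multiplication by `G`
conjugates `∂ + *_g` to `∂`, commutes with `d'`, and commutes with `d` up to `f(0) • d G`. Thus
`qgOp` becomes a weighted shift plus a rank one term (`coeff_expSeries_mul_qgOp`). Iterating gives a
recursion for the moments which, with `w_n = qgWeight q γ n`, is exactly the recursion of an
exponential: `∑ w_n c_n z^n = exp (γ ∑ m_{2l} z^l / l)` (`qgWeight_mul_expCoeff`).

At `γ = -M`, `qγ = -N`, the identified moments turn the right side into `∏ (1 + N r_j z)` by
Newton's identities, while `w_n = 4^n (N! / (N-n)!) (M! / (M-n)!)` for `n ≤ M`. Hence the moments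
match iff `c_n = (N/4)^n E[T^n] / n!` for `n ≤ M`. The finite R-transform encodes the same numbers
as the logarithmic derivative of `E[exp (-TzNM)]`, so the cumulants agree up to scaling. Both
convolutions say that the series of `E[T^n] / n!` multiply modulo `z^(M+1)`. -/

namespace RectDuality

/-! ### Formal exponential series and their coefficients -/

/-- The coefficients of the exponential series `exp (∑_{l ≥ 1} s_l z^l / l)`. -/
noncomputable def expCoeff (s : ℕ → ℝ) : ℕ → ℝ
  | 0 => 1
  | n + 1 => (∑ i : Fin (n + 1), s (n + 1 - i) * expCoeff s i) / (n + 1)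

theorem expCoeff_zero (s : ℕ → ℝ) : expCoeff s 0 = 1 := by rw [expCoeff]

theorem succ_mul_expCoeff (s : ℕ → ℝ) (n : ℕ) :
    ((n : ℝ) + 1) * expCoeff s (n + 1) =
      ∑ i ∈ Finset.range (n + 1), s (i + 1) * expCoeff s (n - i) := by
  have h : (n : ℝ) + 1 ≠ 0 := by positivity
  rw [expCoeff, mul_div_cancel₀ _ h,
    Fin.sum_univ_eq_sum_range (fun i => s (n + 1 - i) * expCoeff s i), ← Finset.sum_range_reflect]
  refine Finset.sum_congr rfl fun i hi => ?_
  rw [Finset.mem_range] at hi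
  congr 2
  omega

/-- The recursion of `expCoeff` determines it. -/
theorem eq_expCoeff_of_rec {s e : ℕ → ℝ} {n : ℕ} (h0 : e 0 = 1)
    (h : ∀ k, k < n → ((k : ℝ) + 1) * e (k + 1) =
      ∑ i ∈ Finset.range (k + 1), s (i + 1) * e (k - i)) :
    ∀ k, k ≤ n → e k = expCoeff s k := by
  intro k
  induction k using Nat.strong_induction_on with
  | _ k ih =>
    intro hk
    cases k with
    | zero => rw [h0, expCoeff_zero]
    | succ k =>
      have hne : (k : ℝ) + 1 ≠ 0 := by positivity
      refine mul_left_cancel₀ hne ?_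
      rw [h k (by omega), succ_mul_expCoeff]
      refine Finset.sum_congr rfl fun i hi => ?_
      rw [ih (k - i) (by omega) (by omega)]

theorem expCoeff_congr {s t : ℕ → ℝ} {n : ℕ} (h : ∀ l, 1 ≤ l → l ≤ n → s l = t l) :
    ∀ k, k ≤ n → expCoeff s k = expCoeff t k := by
  refine eq_expCoeff_of_rec (expCoeff_zero s) fun k hk => ?_
  rw [succ_mul_expCoeff]
  refine Finset.sum_congr rfl fun i hi => ?_
  rw [Finset.mem_range] at hi
  rw [h (i + 1) (by omega) (by omega)]

/-- The recursion is triangular: `s (k + 1)` enters the equation for `expCoeff s (k + 1)` with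
coefficient `expCoeff s 0 = 1`. -/
theorem expCoeff_inj {s t : ℕ → ℝ} {n : ℕ} (h : ∀ k, k ≤ n → expCoeff s k = expCoeff t k) :
    ∀ l, 1 ≤ l → l ≤ n → s l = t l := by
  intro l
  induction l using Nat.strong_induction_on with
  | _ l ih =>
    intro hl hn
    obtain ⟨k, rfl⟩ : ∃ k, l = k + 1 := ⟨l - 1, by omega⟩
    have hs := succ_mul_expCoeff s k
    rw [h _ hn, succ_mul_expCoeff t k, Finset.sum_range_succ, Finset.sum_range_succ,
      Nat.sub_self, expCoeff_zero, expCoeff_zero] at hs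
    have : ∑ i ∈ Finset.range k, t (i + 1) * expCoeff t (k - i) =
        ∑ i ∈ Finset.range k, s (i + 1) * expCoeff s (k - i) := by
      refine Finset.sum_congr rfl fun i hi => ?_
      rw [Finset.mem_range] at hi
      rw [ih (i + 1) (by omega) (by omega) (by omega), h (k - i) (by omega)]
    linarith

theorem expCoeff_eq_iff {s t : ℕ → ℝ} {n : ℕ} :
    (∀ k, k ≤ n → expCoeff s k = expCoeff t k) ↔ ∀ l, 1 ≤ l → l ≤ n → s l = t l :=
  ⟨expCoeff_inj, expCoeff_congr⟩

theorem expCoeff_scale (c : ℝ) (s : ℕ → ℝ) (n : ℕ) :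
    expCoeff (fun l => c ^ l * s l) n = c ^ n * expCoeff s n := by
  refine (eq_expCoeff_of_rec (e := fun n => c ^ n * expCoeff s n) (n := n)
    (by simp [expCoeff_zero]) (fun k _ => ?_) n le_rfl).symm
  rw [mul_left_comm, succ_mul_expCoeff, Finset.mul_sum]
  refine Finset.sum_congr rfl fun i hi => ?_
  rw [Finset.mem_range] at hi
  have : c ^ (k + 1) = c ^ (i + 1) * c ^ (k - i) := by rw [← pow_add]; congr 1; omega
  rw [this]; ring

/-- The exponential series `exp (∑_{l ≥ 1} s_l z^l / l)`. -/
noncomputable def expSeries (s : ℕ → ℝ) : ℝ⟦X⟧ := PowerSeries.mk (expCoeff s)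

theorem coeff_expSeries (s : ℕ → ℝ) (n : ℕ) :
    PowerSeries.coeff n (expSeries s) = expCoeff s n := PowerSeries.coeff_mk _ _

theorem coeff_cumulantSeries_mul (s : ℕ → ℝ) (f : ℝ⟦X⟧) (n : ℕ) :
    PowerSeries.coeff n (cumulantSeries s * f) =
      ∑ i ∈ Finset.range (n + 1), s (i + 1) * PowerSeries.coeff (n - i) f := by
  rw [PowerSeries.coeff_mul, Finset.Nat.sum_antidiagonal_eq_sum_range_succ_mk]
  simp [cumulantSeries]

/-- The equation `f' = g f`, `f(0) = 1` determines `f`; truncated below order `n`, it still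
determines the coefficients up to `n`. -/
theorem coeff_eq_expCoeff_of_derivative {s : ℕ → ℝ} {f : ℝ⟦X⟧}
    (h0 : PowerSeries.coeff 0 f = 1) {n : ℕ}
    (h : ∀ k, k < n → PowerSeries.coeff k (PowerSeries.derivative ℝ f) =
      PowerSeries.coeff k (cumulantSeries s * f)) :
    ∀ k, k ≤ n → PowerSeries.coeff k f = expCoeff s k := by
  refine eq_expCoeff_of_rec h0 fun k hk => ?_
  rw [← coeff_cumulantSeries_mul, ← h k hk, PowerSeries.coeff_derivative, mul_comm]

theorem derivative_expSeries (s : ℕ → ℝ) :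
    PowerSeries.derivative ℝ (expSeries s) = cumulantSeries s * expSeries s := by
  ext n
  rw [PowerSeries.coeff_derivative, coeff_cumulantSeries_mul, mul_comm]
  simp only [coeff_expSeries]
  exact succ_mul_expCoeff s n

theorem expSeries_add (s t : ℕ → ℝ) :
    expSeries (fun l => s l + t l) = expSeries s * expSeries t := by
  ext n
  rw [coeff_expSeries]
  refine (coeff_eq_expCoeff_of_derivative (n := n) ?_ (fun k _ => ?_) n le_rfl).symm
  · simp [PowerSeries.coeff_mul, coeff_expSeries, expCoeff_zero]
  · have hadd : cumulantSeries (fun l => s l + t l) = cumulantSeries s + cumulantSeries t := by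
      ext n; simp [cumulantSeries]
    rw [Derivation.leibniz, derivative_expSeries, derivative_expSeries, hadd]
    congr 1
    simp only [smul_eq_mul]
    ring

theorem expCoeff_add (s t : ℕ → ℝ) (n : ℕ) :
    expCoeff (fun l => s l + t l) n =
      ∑ p ∈ Finset.HasAntidiagonal.antidiagonal n, expCoeff s p.1 * expCoeff t p.2 := by
  simp only [← coeff_expSeries, expSeries_add, PowerSeries.coeff_mul]

/-- The sequence `s` is read off from the logarithmic derivative `f' / f`. -/
theorem exists_expCoeff_eq {e : ℕ → ℝ} (h0 : e 0 = 1) :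
    ∃ s : ℕ → ℝ, ∀ n, expCoeff s n = e n := by
  set f : ℝ⟦X⟧ := PowerSeries.mk e with hf
  have hf0 : PowerSeries.constantCoeff f ≠ 0 := by
    rw [← PowerSeries.coeff_zero_eq_constantCoeff_apply]
    simp [hf, h0]
  refine ⟨fun l => PowerSeries.coeff (l - 1) (PowerSeries.derivative ℝ f * f⁻¹), fun n => ?_⟩
  have hg : cumulantSeries (fun l => PowerSeries.coeff (l - 1)
      (PowerSeries.derivative ℝ f * f⁻¹)) = PowerSeries.derivative ℝ f * f⁻¹ := by
    ext n; simp [cumulantSeries]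
  have := coeff_eq_expCoeff_of_derivative (n := n) (s := fun l => PowerSeries.coeff (l - 1)
      (PowerSeries.derivative ℝ f * f⁻¹)) (f := f) (by simp [hf, h0])
    (fun k _ => by rw [hg, mul_assoc, PowerSeries.inv_mul_cancel _ hf0, mul_one]) n le_rfl
  rw [← this, hf, PowerSeries.coeff_mk]

/-! ### Even exponential series -/

theorem sum_range_two_mul (f : ℕ → ℝ) (n : ℕ) :
    ∑ i ∈ Finset.range (2 * n), f i = ∑ i ∈ Finset.range n, (f (2 * i) + f (2 * i + 1)) := by
  induction n with
  | zero => simp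
  | succ n ih =>
    rw [Nat.mul_succ, Finset.sum_range_succ, Finset.sum_range_succ, ih, Finset.sum_range_succ]
    ring

theorem expCoeff_odd {κ : ℕ → ℝ} (hκ : ∀ l, Odd l → κ l = 0) :
    ∀ n, Odd n → expCoeff κ n = 0 := by
  intro n
  induction n using Nat.strong_induction_on with
  | _ n ih =>
    intro hn
    obtain ⟨k, rfl⟩ : ∃ k, n = k + 1 := ⟨n - 1, by have := hn.pos; omega⟩
    have hne : (k : ℝ) + 1 ≠ 0 := by positivity
    refine (mul_eq_zero.mp ?_).resolve_left hne
    rw [succ_mul_expCoeff]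
    refine Finset.sum_eq_zero fun i hi => ?_
    rw [Finset.mem_range] at hi
    rcases Nat.even_or_odd (i + 1) with h | h
    · rw [ih (k - i) (by omega) (by grind), mul_zero]
    · rw [hκ _ h, zero_mul]

/-- Substitute `w = z²`: the exponent `∑ k_{2l} z^(2l) / (2l)` is `∑ (k_{2l} / 2) w^l / l`, whence
the division by 2. -/
theorem expCoeff_two_mul {κ : ℕ → ℝ} (hκ : ∀ l, Odd l → κ l = 0) (n : ℕ) :
    expCoeff κ (2 * n) = expCoeff (fun l => κ (2 * l) / 2) n := by
  refine eq_expCoeff_of_rec (e := fun n => expCoeff κ (2 * n)) (n := n)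
    (expCoeff_zero κ) (fun k _ => ?_) n le_rfl
  have h := succ_mul_expCoeff κ (2 * k + 1)
  rw [show 2 * k + 1 + 1 = 2 * (k + 1) by ring, sum_range_two_mul] at h
  rw [Nat.cast_succ, Nat.cast_mul, Nat.cast_two] at h
  have h2 : ((k : ℝ) + 1) * expCoeff κ (2 * (k + 1)) =
      (∑ i ∈ Finset.range (k + 1), (κ (2 * i + 1) * expCoeff κ (2 * k + 1 - 2 * i) +
        κ (2 * i + 1 + 1) * expCoeff κ (2 * k + 1 - (2 * i + 1)))) / 2 := by
    rw [← h]; ring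
  rw [h2, Finset.sum_div]
  refine Finset.sum_congr rfl fun i hi => ?_
  rw [hκ (2 * i + 1) (odd_two_mul_add_one i),
    show 2 * k + 1 - (2 * i + 1) = 2 * (k - i) by omega]
  ring_nf

/-! ### Conjugation of the q-γ operator and the moment-cumulant relation -/

theorem cumulantToMoment_eq (q γ : ℝ) (κ : ℕ → ℝ) {k : ℕ} (hk : 1 ≤ k) :
    cumulantToMoment q γ κ k =
      PowerSeries.coeff 0 ((qgOp q γ (cumulantSeries κ))^[2 * k] 1) := by
  have h1 : qgOp q γ (cumulantSeries κ) 1 = cumulantSeries κ := by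
    have hs : shiftOp 1 = 0 := by ext n; simp [shiftOp, PowerSeries.coeff_one]
    have ho : oddShiftOp 1 = 0 := by ext n; simp [oddShiftOp, PowerSeries.coeff_one]
    simp [qgOp, hs, ho]
  obtain ⟨j, hj⟩ : ∃ j, 2 * k = j + 1 := ⟨2 * k - 1, by omega⟩
  rw [cumulantToMoment, hj, Nat.add_sub_cancel, Function.iterate_succ_apply, h1]

/-- Since `f = f(0) + z • d f`, the shift fails to commute with multiplication by `G` only through
the term `f(0) • d G`. -/
theorem coeff_mul_shiftOp (G f : ℝ⟦X⟧) (n : ℕ) :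
    PowerSeries.coeff n (G * shiftOp f) = PowerSeries.coeff (n + 1) (G * f) -
      PowerSeries.coeff 0 f * PowerSeries.coeff (n + 1) G := by
  have hf : f = shiftOp f * PowerSeries.X + PowerSeries.C (PowerSeries.coeff 0 f) := by
    ext n
    cases n with
    | zero => simp
    | succ n => simp [PowerSeries.coeff_succ_mul_X, shiftOp]
  have h : G * f = G * shiftOp f * PowerSeries.X +
      PowerSeries.C (PowerSeries.coeff 0 f) * G := by
    conv_lhs => rw [hf]
    ring
  rw [h, map_add, PowerSeries.coeff_succ_mul_X, PowerSeries.coeff_C_mul, add_sub_cancel_right]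

/-- Here `d' f = (f(z) - f(-z)) / z`, and an even `G` passes through `z ↦ -z`, so no correction term
arises. -/
theorem coeff_mul_oddShiftOp {G : ℝ⟦X⟧} (hG : ∀ n, Odd n → PowerSeries.coeff n G = 0)
    (f : ℝ⟦X⟧) (n : ℕ) :
    PowerSeries.coeff n (G * oddShiftOp f) =
      if Odd (n + 1) then 2 * PowerSeries.coeff (n + 1) (G * f) else 0 := by
  have hGe : PowerSeries.rescale (-1) G = G := by
    ext n
    rw [PowerSeries.coeff_rescale]
    rcases Nat.even_or_odd n with h | h
    · rw [h.neg_one_pow, one_mul]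
    · rw [hG n h, mul_zero]
  have hf : oddShiftOp f * PowerSeries.X = f - PowerSeries.rescale (-1) f := by
    ext n
    cases n with
    | zero =>
      rw [PowerSeries.coeff_zero_mul_X, map_sub, PowerSeries.coeff_rescale, pow_zero, one_mul,
        sub_self]
    | succ n =>
      rw [PowerSeries.coeff_succ_mul_X, oddShiftOp, PowerSeries.coeff_mk, map_sub,
        PowerSeries.coeff_rescale]
      split_ifs with h
      · rw [h.neg_one_pow]; ring
      · rw [(Nat.not_odd_iff_even.mp h).neg_one_pow]; ring
  rw [← PowerSeries.coeff_succ_mul_X, mul_assoc, hf, mul_sub]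
  conv_lhs => rw [show G * PowerSeries.rescale (-1) f = PowerSeries.rescale (-1) (G * f) by
    rw [map_mul, hGe]]
  rw [map_sub, PowerSeries.coeff_rescale]
  split_ifs with h
  · rw [h.neg_one_pow]; ring
  · rw [(Nat.not_odd_iff_even.mp h).neg_one_pow]; ring

/-- The factor in `(∂ + 2γ d + ((q-1)γ - 1/2) d') z^n = qgFactor q γ n • z^(n-1)`, `n ≥ 1`. -/
noncomputable def qgFactor (q γ : ℝ) (n : ℕ) : ℝ :=
  n + 2 * γ + if Odd n then 2 * ((q - 1) * γ - 1 / 2) else 0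

/-- Conjugation by `exp ∫ g` turns `qgOp` into a weighted shift, up to a rank one term. -/
theorem coeff_expSeries_mul_qgOp (q γ : ℝ) {κ : ℕ → ℝ} (hκ : ∀ l, Odd l → κ l = 0)
    (f : ℝ⟦X⟧) (n : ℕ) :
    PowerSeries.coeff n (expSeries κ * qgOp q γ (cumulantSeries κ) f) =
      qgFactor q γ (n + 1) * PowerSeries.coeff (n + 1) (expSeries κ * f) -
        2 * γ * PowerSeries.coeff 0 f * expCoeff κ (n + 1) := by
  have hd : expSeries κ * PowerSeries.derivative ℝ f + expSeries κ * (cumulantSeries κ * f) =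
      PowerSeries.derivative ℝ (expSeries κ * f) := by
    rw [Derivation.leibniz, derivative_expSeries]
    simp only [smul_eq_mul]
    ring
  have h : expSeries κ * qgOp q γ (cumulantSeries κ) f =
      PowerSeries.derivative ℝ (expSeries κ * f) + (2 * γ) • (expSeries κ * shiftOp f) +
        ((q - 1) * γ - 1 / 2) • (expSeries κ * oddShiftOp f) := by
    rw [← hd, qgOp, mul_add, mul_add, mul_add, mul_smul_comm, mul_smul_comm]
    ring
  have hG : ∀ n, Odd n → PowerSeries.coeff n (expSeries κ) = 0 := fun n hn => by
    rw [coeff_expSeries, expCoeff_odd hκ n hn]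
  rw [h, map_add, map_add, PowerSeries.coeff_smul, PowerSeries.coeff_smul, coeff_mul_shiftOp,
    coeff_mul_oddShiftOp hG, PowerSeries.coeff_derivative, coeff_expSeries, qgFactor]
  simp only [smul_eq_mul, Nat.cast_add, Nat.cast_one]
  split_ifs <;> ring

/-- The product `qgFactor q γ 1 * ⋯ * qgFactor q γ n`. -/
noncomputable def qgFactorial (q γ : ℝ) (n : ℕ) : ℝ := ∏ i ∈ Finset.range n, qgFactor q γ (i + 1)

theorem qgFactorial_succ (q γ : ℝ) (n : ℕ) :
    qgFactorial q γ (n + 1) = qgFactorial q γ n * qgFactor q γ (n + 1) :=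
  Finset.prod_range_succ _ _

/-- The moments `[z^0] (∂ + 2γ d + ((q-1)γ - 1/2) d' + *_g)^k 1`, of all orders. -/
noncomputable def qgMoment (q γ : ℝ) (κ : ℕ → ℝ) (k : ℕ) : ℝ :=
  PowerSeries.coeff 0 ((qgOp q γ (cumulantSeries κ))^[k] 1)

/-- The prefactor `qgFactorial q γ n` absorbs the weight of each shift. The rank one term at step
`j` contributes the constant term of the `j`-th iterate, which is a moment. -/
theorem qgFactorial_mul_coeff_iterate (q γ : ℝ) {κ : ℕ → ℝ} (hκ : ∀ l, Odd l → κ l = 0)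
    (k n : ℕ) :
    qgFactorial q γ n *
        PowerSeries.coeff n (expSeries κ * (qgOp q γ (cumulantSeries κ))^[k] 1) =
      qgFactorial q γ (n + k) * expCoeff κ (n + k) - 2 * γ * ∑ j ∈ Finset.range k,
        qgMoment q γ κ j * (qgFactorial q γ (n + k - 1 - j) * expCoeff κ (n + k - j)) := by
  induction k generalizing n with
  | zero => simp [coeff_expSeries]
  | succ k ih =>
    rw [Function.iterate_succ_apply', coeff_expSeries_mul_qgOp q γ hκ, mul_sub, ← mul_assoc,
      ← qgFactorial_succ, ih, Finset.sum_range_succ]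
    have e1 : n + 1 + k = n + (k + 1) := by ring
    have e2 : n + (k + 1) - 1 - k = n := by omega
    have e3 : n + (k + 1) - k = n + 1 := by omega
    rw [e1, e2, e3]
    simp only [qgMoment]
    ring

theorem qgMoment_eq (q γ : ℝ) {κ : ℕ → ℝ} (hκ : ∀ l, Odd l → κ l = 0) (k : ℕ) :
    qgMoment q γ κ k = qgFactorial q γ k * expCoeff κ k - 2 * γ * ∑ j ∈ Finset.range k,
        qgMoment q γ κ j * (qgFactorial q γ (k - 1 - j) * expCoeff κ (k - j)) := by
  have h := qgFactorial_mul_coeff_iterate q γ hκ k 0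
  have h0 : PowerSeries.coeff 0 (expSeries κ * (qgOp q γ (cumulantSeries κ))^[k] 1) =
      qgMoment q γ κ k := by
    simp [qgMoment, PowerSeries.coeff_mul, coeff_expSeries, expCoeff_zero]
  rw [h0] at h
  simpa [qgFactorial] using h

/-- The factor between the coefficients of the exponential series of the cumulants and of the
moments. -/
noncomputable def qgWeight (q γ : ℝ) (n : ℕ) : ℝ :=
  4 ^ n * ∏ i ∈ Finset.range n, ((i + q * γ) * (i + γ))

/-- Consecutive factors pair up: in odd degree the `-1/2` cancels the odd part and leaves `2 (n +
qγ)`, in even degree `2 (n + 1 + γ)` remains. The prefactor `2γ` supplies the missing factor with `i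
= 0`. -/
theorem qgWeight_succ (q γ : ℝ) (n : ℕ) :
    qgWeight q γ (n + 1) = 2 * γ * qgFactorial q γ (2 * n + 1) := by
  have hodd : ∀ n : ℕ, qgFactor q γ (2 * n + 1) = 2 * (n + q * γ) := fun n => by
    rw [qgFactor, if_pos (odd_two_mul_add_one n)]; push_cast; ring
  have heven : ∀ n : ℕ, qgFactor q γ (2 * n + 1 + 1) = 2 * (n + 1 + γ) := fun n => by
    rw [qgFactor, if_neg (by grind)]; push_cast; ring
  induction n with
  | zero => have := hodd 0; simp at this; simp [qgWeight, qgFactorial, this]; ring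
  | succ n ih =>
    rw [show 2 * (n + 1) + 1 = 2 * n + 1 + 1 + 1 by ring, qgFactorial_succ, qgFactorial_succ,
      heven, show 2 * n + 1 + 1 + 1 = 2 * (n + 1) + 1 by ring, hodd]
    have : qgWeight q γ (n + 1 + 1) = qgWeight q γ (n + 1) *
        (4 * ((n + 1 : ℕ) + q * γ) * ((n + 1 : ℕ) + γ)) := by
      rw [qgWeight, qgWeight, Finset.prod_range_succ _ (n + 1)]; ring
    rw [this, ih]; push_cast; ring

theorem gamma_mul_qgFactorial (q γ : ℝ) (n : ℕ) :
    2 * γ * qgFactorial q γ (2 * (n + 1)) = 2 * (n + 1 + γ) * qgWeight q γ (n + 1) := by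
  rw [show 2 * (n + 1) = 2 * n + 1 + 1 by ring, qgFactorial_succ, qgWeight_succ, qgFactor,
    if_neg (by grind)]
  push_cast; ring

/-- The moment-cumulant relation: coefficientwise and up to the weights `qgWeight q γ`, the series
`exp (∑ k_{2l} z^l / (2l))` is `exp (γ ∑ m_{2l} z^l / l)`. -/
theorem qgWeight_mul_expCoeff (q γ : ℝ) {κ : ℕ → ℝ} (hκ : ∀ l, Odd l → κ l = 0) (n : ℕ) :
    qgWeight q γ n * expCoeff (fun l => κ (2 * l) / 2) n =
      expCoeff (fun l => γ * cumulantToMoment q γ κ l) n := by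
  refine eq_expCoeff_of_rec (e := fun n => qgWeight q γ n * expCoeff (fun l => κ (2 * l) / 2) n)
    (n := n) (by simp [qgWeight, expCoeff_zero]) (fun k _ => ?_) n le_rfl
  have h := qgMoment_eq q γ hκ (2 * (k + 1))
  rw [sum_range_two_mul, Finset.sum_range_succ'] at h
  have hz : qgMoment q γ κ (2 * 0) = 1 := by simp [qgMoment]
  -- In each pair of summands the odd one carries an odd coefficient of an even series, so its
  -- moment, here `x`, is irrelevant.
  have hterm : ∀ i, i ≤ k → ∀ x,
      qgMoment q γ κ (2 * i) * (qgFactorial q γ (2 * (k + 1) - 1 - 2 * i) *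
        expCoeff κ (2 * (k + 1) - 2 * i)) +
      x * (qgFactorial q γ (2 * (k + 1) - 1 - (2 * i + 1)) *
        expCoeff κ (2 * (k + 1) - (2 * i + 1))) =
      qgMoment q γ κ (2 * i) * (qgFactorial q γ (2 * (k - i) + 1) *
        expCoeff (fun l => κ (2 * l) / 2) (k - i + 1)) := by
    intro i hi x
    rw [expCoeff_odd hκ (2 * (k + 1) - (2 * i + 1)) (by grind), ← expCoeff_two_mul hκ,
      show 2 * (k + 1) - 1 - 2 * i = 2 * (k - i) + 1 by omega,
      show 2 * (k + 1) - 2 * i = 2 * (k - i + 1) by omega]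
    ring
  rw [hterm 0 (Nat.zero_le _), hz, Finset.sum_congr rfl fun i hi =>
    hterm (i + 1) (by rw [Finset.mem_range] at hi; omega) _, expCoeff_two_mul hκ] at h
  rw [Finset.sum_range_succ, Nat.sub_self, expCoeff_zero, cumulantToMoment_eq q γ κ (by omega)]
  change _ = _ + γ * qgMoment q γ κ (2 * (k + 1)) * _
  have hsum : ∑ i ∈ Finset.range k, γ * cumulantToMoment q γ κ (i + 1) *
      (qgWeight q γ (k - i) * expCoeff (fun l => κ (2 * l) / 2) (k - i)) =
      γ * (2 * γ * ∑ i ∈ Finset.range k, qgMoment q γ κ (2 * (i + 1)) *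
        (qgFactorial q γ (2 * (k - (i + 1)) + 1) *
          expCoeff (fun l => κ (2 * l) / 2) (k - (i + 1) + 1))) := by
    simp only [Finset.mul_sum]
    refine Finset.sum_congr rfl fun i hi => ?_
    rw [Finset.mem_range] at hi
    have e : k - i = k - (i + 1) + 1 := by omega
    rw [cumulantToMoment_eq q γ κ (by omega), e, qgWeight_succ, qgMoment]
    ring
  have hw0 : qgWeight q γ 0 = 1 := by simp [qgWeight]
  have hg := gamma_mul_qgFactorial q γ k
  rw [hsum, hw0]
  have hw := qgWeight_succ q γ k
  rw [Nat.sub_zero] at h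
  -- The `j = 0` summand cancels the `γ` in the factor `k + 1 + γ` of `hg`, leaving the factor `k +
  -- 1` of the exponential recursion.
  linear_combination (-γ) * h - (1 / 2) * expCoeff (fun l => κ (2 * l) / 2) (k + 1) * hg -
    γ * expCoeff (fun l => κ (2 * l) / 2) (k + 1) * hw

/-! ### Newton's identities and the weights at `γ = -M`, `q = N / M` -/

theorem succ_mul_sqEsymm {M : ℕ} (a : Fin M → ℝ) (k : ℕ) :
    ((k : ℝ) + 1) * sqEsymm a (k + 1) = ∑ i ∈ Finset.range (k + 1),
      (-((-1) ^ (i + 1) * ∑ j, (a j ^ 2) ^ (i + 1))) * sqEsymm a (k - i) := by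
  have he : ∀ n, MvPolynomial.aeval (fun j => a j ^ 2) (MvPolynomial.esymm (Fin M) ℝ n) =
      sqEsymm a n := fun n => by simp [MvPolynomial.esymm, sqEsymm]
  have hp : ∀ n, MvPolynomial.aeval (fun j => a j ^ 2) (MvPolynomial.psum (Fin M) ℝ n) =
      ∑ j, (a j ^ 2) ^ n := fun n => by simp [MvPolynomial.psum]
  have h := congrArg (MvPolynomial.aeval (fun j => a j ^ 2))
    (MvPolynomial.mul_esymm_eq_sum (Fin M) ℝ (k + 1))
  simp only [map_mul, map_sum, map_pow, map_neg, map_one, map_natCast, he, hp] at h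
  -- The filter removes exactly the last index of the range, where the power sum would have degree
  -- 0.
  rw [Finset.sum_filter, Finset.Nat.sum_antidiagonal_eq_sum_range_succ_mk,
    Finset.sum_range_succ] at h
  simp only [lt_irrefl, if_false, add_zero] at h
  rw [Nat.cast_succ] at h
  rw [h, ← Finset.sum_range_reflect, Finset.mul_sum]
  refine Finset.sum_congr rfl fun i hi => ?_
  rw [Finset.mem_range] at hi
  obtain ⟨j, rfl⟩ : ∃ j, k = i + j := ⟨k - i, by omega⟩
  rw [if_pos (by omega), show i + j + 1 - 1 - i = j by omega, show i + j + 1 - j = i + 1 by omega,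
    show i + j - i = j by omega, show i + j + 1 + 1 = i + (j + 2) by ring]
  have hj : ((-1 : ℝ) ^ j) * (-1) ^ j = 1 := by rw [← mul_pow]; norm_num
  simp only [pow_add]
  linear_combination ((-1) ^ i * sqEsymm a j * ∑ x, (a x ^ 2) ^ i * (a x ^ 2) ^ 1) * hj

/-- The exponential of `-M ∑ m'_l (-N)^l z^l / l` is `∏ (1 + N r_j z)`. -/
theorem expCoeff_dualMoment {M : ℕ} (hM : M ≠ 0) (N : ℕ) (a : Fin M → ℝ) (n : ℕ) :
    expCoeff (fun l => -(M : ℝ) * dualMoment N a l) n = (N : ℝ) ^ n * sqEsymm a n := by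
  have hM' : (M : ℝ) ≠ 0 := Nat.cast_ne_zero.mpr hM
  have h1 : (fun l => -(M : ℝ) * dualMoment N a l) =
      fun l => (N : ℝ) ^ l * -((-1) ^ l * ∑ j, (a j ^ 2) ^ l) := by
    funext l
    rw [dualMoment, finMoment, neg_pow]
    field_simp
  rw [h1, expCoeff_scale, eq_expCoeff_of_rec (s := fun l => -((-1) ^ l * ∑ j, (a j ^ 2) ^ l))
    (e := sqEsymm a) (by simp [sqEsymm])
    (fun k _ => succ_mul_sqEsymm a k) n le_rfl]

theorem prod_sub_mul_factorial {N n : ℕ} (h : n ≤ N) :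
    (∏ i ∈ Finset.range n, ((i : ℝ) - N)) * (N - n)! = (-1) ^ n * N ! := by
  induction n with
  | zero => simp
  | succ n ih =>
    have h1 : N - n = N - (n + 1) + 1 := by omega
    have h2 : ((N - (n + 1) : ℕ) : ℝ) + 1 = N - n := by
      rw [Nat.cast_sub h]; push_cast; ring
    have h3 := ih (by omega)
    rw [h1, Nat.factorial_succ, Nat.cast_mul, Nat.cast_succ, h2] at h3
    rw [Finset.prod_range_succ, pow_succ]
    linear_combination -h3

theorem qgWeight_mul_factorial {M N n : ℕ} (hM : M ≠ 0) (hMN : M ≤ N) (hn : n ≤ M) :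
    qgWeight ((N : ℝ) / M) (-(M : ℝ)) n * ((N - n)! * (M - n)!) = 4 ^ n * (N ! * M !) := by
  have hM' : (M : ℝ) ≠ 0 := Nat.cast_ne_zero.mpr hM
  have h1 : (N : ℝ) / M * -(M : ℝ) = -N := by field_simp
  have hN := prod_sub_mul_factorial (hn.trans hMN)
  have hMM := prod_sub_mul_factorial hn
  have hs : ((-1 : ℝ) ^ n) * (-1) ^ n = 1 := by rw [← mul_pow]; norm_num
  rw [qgWeight, h1, Finset.prod_mul_distrib]
  simp only [← sub_eq_add_neg]
  calc _ = 4 ^ n * (((∏ i ∈ Finset.range n, ((i : ℝ) - N)) * (N - n)!) *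
        ((∏ i ∈ Finset.range n, ((i : ℝ) - M)) * (M - n)!)) := by ring
    _ = _ := by rw [hN, hMM]; linear_combination (4 ^ n * (N ! * M ! : ℝ)) * hs

/-- Beyond `n = M` the factor with `i = M` kills the weight, so only the first `M` even moments can
be inverted. -/
theorem qgWeight_ne_zero {M N n : ℕ} (hM : M ≠ 0) (hMN : M ≤ N) (hn : n ≤ M) :
    qgWeight ((N : ℝ) / M) (-(M : ℝ)) n ≠ 0 := by
  intro h
  have h1 := qgWeight_mul_factorial hM hMN hn
  rw [h, zero_mul] at h1
  have : (4 : ℝ) ^ n * (N ! * M !) ≠ 0 := by positivity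
  exact this h1.symm

/-- The coefficients `E[T^i] / i!` of the series `E[exp (T z)]`. -/
noncomputable def rectCoeff (M N : ℕ) (a : Fin M → ℝ) (i : ℕ) : ℝ := rectTMoment M N a i / i !

theorem rectCoeff_eq (M N : ℕ) (a : Fin M → ℝ) (i : ℕ) :
    rectCoeff M N a i = ((N - i)! * (M - i)! : ℝ) / (N ! * M !) * sqEsymm a i := by
  rw [rectCoeff, rectTMoment]
  push_cast
  field_simp

theorem qgWeight_mul_rectCoeff {M N n : ℕ} (hM : M ≠ 0) (hMN : M ≤ N) (hn : n ≤ M)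
    (a : Fin M → ℝ) :
    qgWeight ((N : ℝ) / M) (-(M : ℝ)) n * (((N : ℝ) / 4) ^ n * rectCoeff M N a n) =
      (N : ℝ) ^ n * sqEsymm a n := by
  have h := qgWeight_mul_factorial hM hMN hn
  have hne : (N ! * M ! : ℝ) ≠ 0 := by positivity
  rw [rectCoeff_eq, div_pow, div_mul_eq_mul_div, mul_div_assoc', div_mul_eq_mul_div,
    mul_div_assoc', mul_div_assoc', div_div, div_eq_iff (by positivity)]
  linear_combination ((N : ℝ) ^ n * sqEsymm a n) * h

/-! ### Both moment-cumulant relations in terms of `rectCoeff` -/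

theorem cumulantToMoment_eq_iff {q γ : ℝ} (hγ : γ ≠ 0) {κ : ℕ → ℝ} (hκ : ∀ l, Odd l → κ l = 0)
    (m : ℕ → ℝ) (n : ℕ) :
    (∀ k, 1 ≤ k → k ≤ n → cumulantToMoment q γ κ k = m k) ↔
      ∀ k, k ≤ n → qgWeight q γ k * expCoeff (fun l => κ (2 * l) / 2) k =
        expCoeff (fun l => γ * m l) k := by
  simp only [qgWeight_mul_expCoeff q γ hκ, expCoeff_eq_iff]
  simp [hγ]

theorem cumulantToMoment_eq_dualMoment_iff {M N : ℕ} (hM : M ≠ 0) (hMN : M ≤ N) {κ : ℕ → ℝ}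
    (hκ : ∀ l, Odd l → κ l = 0) (a : Fin M → ℝ) :
    (∀ k, 1 ≤ k → k ≤ M →
        cumulantToMoment ((N : ℝ) / M) (-(M : ℝ)) κ k = dualMoment N a k) ↔
      ∀ k, k ≤ M → expCoeff (fun l => κ (2 * l) / 2) k =
        ((N : ℝ) / 4) ^ k * rectCoeff M N a k := by
  rw [cumulantToMoment_eq_iff (neg_ne_zero.mpr (Nat.cast_ne_zero.mpr hM)) hκ]
  refine forall₂_congr fun k hk => ?_
  rw [expCoeff_dualMoment hM, ← qgWeight_mul_rectCoeff hM hMN hk,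
    mul_right_inj' (qgWeight_ne_zero hM hMN hk)]

/-- By definition `-M R ≡ z (ln E[exp (-TzNM)])'`, so exponentiating returns the Laplace
coefficients; truncating `R` does not affect those of order at most `M`. -/
theorem expCoeff_rectCumulant {M N : ℕ} (hM : M ≠ 0) (a : Fin M → ℝ) {k : ℕ} (hk : k ≤ M) :
    expCoeff (fun l => -(M : ℝ) * rectCumulant M N a l) k =
      (-((N : ℝ) * M)) ^ k * rectCoeff M N a k := by
  have hM' : (M : ℝ) ≠ 0 := Nat.cast_ne_zero.mpr hM
  set f := formalLaplace (rectTMoment M N a) ((N : ℝ) * M) with hf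
  have hf0 : PowerSeries.coeff 0 f = 1 := by simp [hf, formalLaplace, rectTMoment_zero]
  have hs : cumulantSeries (fun l => -(M : ℝ) *
      PowerSeries.coeff l (rectRSeries M N (rectTMoment M N a))) =
      PowerSeries.derivative ℝ (PowerSeries.logOf f) := by
    ext n
    rw [cumulantSeries, PowerSeries.coeff_mk, rectRSeries, PowerSeries.coeff_smul,
      PowerSeries.coeff_succ_X_mul, smul_eq_mul, ← mul_assoc,
      show -(M : ℝ) * (-1 / M) = 1 by field_simp, one_mul]
  have h := coeff_eq_expCoeff_of_derivative hf0 (n := M) (fun k _ => by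
    rw [hs, derivative_logOf f (by
      rw [← PowerSeries.coeff_zero_eq_constantCoeff_apply, hf0])]) k hk
  rw [expCoeff_congr (n := M) (fun l _ hl => ?_) k hk, ← h, hf, formalLaplace,
    PowerSeries.coeff_mk, rectCoeff]
  · ring
  · rw [rectCumulant, rectRTransform, PowerSeries.coeff_trunc, if_pos (by omega)]

theorem rectCumulant_eq_iff {M N : ℕ} (hM : M ≠ 0) (a : Fin M → ℝ) (κ : ℕ → ℝ) :
    (∀ l, 1 ≤ l → l ≤ M →
        rectCumulant M N a l = 4 ^ l * (κ (2 * l) / 2) * (-(M : ℝ)) ^ (l - 1)) ↔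
      ∀ k, k ≤ M → expCoeff (fun l => κ (2 * l) / 2) k =
        ((N : ℝ) / 4) ^ k * rectCoeff M N a k := by
  have hM' : -(M : ℝ) ≠ 0 := neg_ne_zero.mpr (Nat.cast_ne_zero.mpr hM)
  -- Multiplying by `γ = -M` completes `γ^(l-1)` to `γ^l`, so the relation becomes the rescaling `z
  -- ↦ 4γz` of exponential series.
  calc _ ↔ ∀ l, 1 ≤ l → l ≤ M → (4 * -(M : ℝ)) ^ l * (κ (2 * l) / 2) =
        -(M : ℝ) * rectCumulant M N a l := by
        refine forall₃_congr fun l hl _ => ?_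
        obtain ⟨j, rfl⟩ : ∃ j, l = j + 1 := ⟨l - 1, by omega⟩
        rw [Nat.add_sub_cancel, ← mul_right_inj' hM', eq_comm, mul_pow, pow_succ (-(M : ℝ)) j]
        ring_nf
    _ ↔ _ := by
        rw [← expCoeff_eq_iff (s := fun l => (4 * -(M : ℝ)) ^ l * (κ (2 * l) / 2))
          (t := fun l => -(M : ℝ) * rectCumulant M N a l)]
        refine forall₂_congr fun k hk => ?_
        rw [expCoeff_scale, expCoeff_rectCumulant hM a hk,
          show -((N : ℝ) * M) = 4 * -(M : ℝ) * (N / 4) by ring, mul_pow _ ((N : ℝ) / 4), mul_assoc,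
          mul_right_inj' (pow_ne_zero _ (mul_ne_zero four_ne_zero hM'))]

/-! ### The finite convolution as a Cauchy product -/

theorem sum_C_mul_X_pow_eq_iff (M : ℕ) (x y : ℕ → ℝ) :
    ∑ l ∈ Finset.range (M + 1), Polynomial.C (x l) * Polynomial.X ^ (M - l) =
        ∑ l ∈ Finset.range (M + 1), Polynomial.C (y l) * Polynomial.X ^ (M - l) ↔
      ∀ l, l ≤ M → x l = y l := by
  have key : ∀ (z : ℕ → ℝ) (k : ℕ), k ≤ M → (∑ l ∈ Finset.range (M + 1),
      Polynomial.C (z l) * Polynomial.X ^ (M - l)).coeff (M - k) = z k := by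
    intro z k hk
    simp_rw [Polynomial.finsetSum_coeff, Polynomial.coeff_C_mul_X_pow]
    rw [Finset.sum_eq_single_of_mem k (by simp; omega)] <;> grind
  constructor
  · intro h l hl
    rw [← key x l hl, h, key y l hl]
  · intro h
    refine Finset.sum_congr rfl fun l hl => ?_
    rw [Finset.mem_range] at hl
    rw [h l (by omega)]

theorem prod_X_sub_C_sq {M : ℕ} (c : Fin M → ℝ) :
    ∏ j, (Polynomial.X - Polynomial.C (c j ^ 2)) = ∑ l ∈ Finset.range (M + 1),
      Polynomial.C ((-1) ^ l * sqEsymm c l) * Polynomial.X ^ (M - l) := by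
  have h := Multiset.prod_X_sub_X_eq_sum_esymm (Finset.univ.val.map fun j => c j ^ 2)
  simp only [Multiset.map_map, Function.comp_def, Multiset.card_map, Finset.card_val,
    Finset.card_univ, Fintype.card_fin, Finset.esymm_map_val] at h
  refine Eq.trans h (Finset.sum_congr rfl fun l _ => ?_)
  simp [sqEsymm, mul_assoc]

/-- Multiplying the `l`-th coefficient by `(N-l)! (M-l)! / (N! M!)` distributes the factorials over
the two factors. -/
theorem isRectFiniteConv_iff {M N : ℕ} (a b c : Fin M → ℝ) :
    IsRectFiniteConv M N a b c ↔ ∀ l, l ≤ M → rectCoeff M N c l =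
      ∑ p ∈ Finset.HasAntidiagonal.antidiagonal l,
        rectCoeff M N a p.1 * rectCoeff M N b p.2 := by
  rw [IsRectFiniteConv, prod_X_sub_C_sq, rectConvPoly, sum_C_mul_X_pow_eq_iff]
  refine forall₂_congr fun l _ => ?_
  rw [mul_right_inj' (pow_ne_zero _ (by norm_num)), rectCoeff_eq]
  have hne : ((N - l)! * (M - l)! : ℝ) / (N ! * M !) ≠ 0 := by positivity
  rw [← mul_right_inj' hne, Finset.mul_sum]
  refine iff_of_eq (congrArg _ (Finset.sum_congr rfl fun p _ => ?_))
  rw [rectCoeff_eq, rectCoeff_eq]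
  push_cast
  field_simp

/-! ### Existence and uniqueness of q-γ cumulants, and the q-γ convolution -/

theorem exists_isQGammaCumulants {M N : ℕ} (hM : M ≠ 0) (hMN : M ≤ N) (m : ℕ → ℝ) :
    ∃ κ, IsQGammaCumulants ((N : ℝ) / M) (-(M : ℝ)) M κ m := by
  -- For `k > M` the weight is 0 and the quotient takes the default value 0; only `k ≤ M` is used.
  obtain ⟨s, hs⟩ := exists_expCoeff_eq (e := fun k => expCoeff (fun l => -(M : ℝ) * m l) k /
    qgWeight ((N : ℝ) / M) (-(M : ℝ)) k) (by simp [expCoeff_zero, qgWeight])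
  have hodd : ∀ l, Odd l → (fun l => if Odd l then 0 else 2 * s (l / 2)) l = 0 :=
    fun l hl => if_pos hl
  refine ⟨fun l => if Odd l then 0 else 2 * s (l / 2), hodd, ?_⟩
  rw [cumulantToMoment_eq_iff (neg_ne_zero.mpr (Nat.cast_ne_zero.mpr hM)) hodd]
  intro k hk
  have : (fun l => (fun l => if Odd l then 0 else 2 * s (l / 2)) (2 * l) / 2) = s := by
    funext l
    have : ¬ Odd (2 * l) := by grind
    simp [this]
  rw [this, hs, mul_div_cancel₀ _ (qgWeight_ne_zero hM hMN hk)]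

theorem IsQGammaCumulants.unique {M N : ℕ} (hM : M ≠ 0) (hMN : M ≤ N) {m κ κ' : ℕ → ℝ}
    (h : IsQGammaCumulants ((N : ℝ) / M) (-(M : ℝ)) M κ m)
    (h' : IsQGammaCumulants ((N : ℝ) / M) (-(M : ℝ)) M κ' m) :
    ∀ l, l ≤ M → 1 ≤ l → κ' (2 * l) / 2 = κ (2 * l) / 2 := by
  have hγ : -(M : ℝ) ≠ 0 := neg_ne_zero.mpr (Nat.cast_ne_zero.mpr hM)
  have e := (cumulantToMoment_eq_iff hγ h.1 m M).mp h.2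
  have e' := (cumulantToMoment_eq_iff hγ h'.1 m M).mp h'.2
  intro l hl h1
  refine expCoeff_inj (s := fun l => κ' (2 * l) / 2) (t := fun l => κ (2 * l) / 2) (n := M)
    (fun k hk => ?_) l h1 hl
  exact mul_left_cancel₀ (qgWeight_ne_zero hM hMN hk) ((e' k hk).trans (e k hk).symm)

theorem cumulantToMoment_congr {q γ : ℝ} (hγ : γ ≠ 0) {κ κ' : ℕ → ℝ}
    (hκ : ∀ l, Odd l → κ l = 0) (hκ' : ∀ l, Odd l → κ' l = 0) {n : ℕ}
    (h : ∀ l, 1 ≤ l → l ≤ n → κ' (2 * l) / 2 = κ (2 * l) / 2) :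
    ∀ k, 1 ≤ k → k ≤ n → cumulantToMoment q γ κ' k = cumulantToMoment q γ κ k := by
  rw [cumulantToMoment_eq_iff hγ hκ']
  intro k hk
  rw [← qgWeight_mul_expCoeff q γ hκ,
    expCoeff_congr (s := fun l => κ' (2 * l) / 2) (t := fun l => κ (2 * l) / 2) h k hk]

theorem isQGammaConv_dualMoment_iff {M N : ℕ} (hM : M ≠ 0) (hMN : M ≤ N) (a b c : Fin M → ℝ) :
    IsQGammaConv ((N : ℝ) / M) (-(M : ℝ)) M (dualMoment N a) (dualMoment N b) (dualMoment N c) ↔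
      ∀ l, l ≤ M → rectCoeff M N c l = ∑ p ∈ Finset.HasAntidiagonal.antidiagonal l,
        rectCoeff M N a p.1 * rectCoeff M N b p.2 := by
  have hN : ((N : ℝ) / 4) ≠ 0 := by
    have : (N : ℝ) ≠ 0 := Nat.cast_ne_zero.mpr (by omega)
    positivity
  -- The criterion holds for every choice of cumulants of `a` and `b`, so it settles both directions
  -- of the existential. Adding cumulants multiplies exponential series, and the powers of `N/4`
  -- cancel by homogeneity.
  have key : ∀ κa κb : ℕ → ℝ,
      IsQGammaCumulants ((N : ℝ) / M) (-(M : ℝ)) M κa (dualMoment N a) →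
      IsQGammaCumulants ((N : ℝ) / M) (-(M : ℝ)) M κb (dualMoment N b) →
      (IsQGammaCumulants ((N : ℝ) / M) (-(M : ℝ)) M (fun l => κa l + κb l) (dualMoment N c) ↔
        ∀ l, l ≤ M → rectCoeff M N c l = ∑ p ∈ Finset.HasAntidiagonal.antidiagonal l,
          rectCoeff M N a p.1 * rectCoeff M N b p.2) := by
    rintro κa κb ⟨ha, ha'⟩ ⟨hb, hb'⟩
    have hab : ∀ l, Odd l → (fun l => κa l + κb l) l = 0 := fun l hl => by simp [ha l hl, hb l hl]
    rw [cumulantToMoment_eq_dualMoment_iff hM hMN ha] at ha'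
    rw [cumulantToMoment_eq_dualMoment_iff hM hMN hb] at hb'
    rw [IsQGammaCumulants, and_iff_right hab, cumulantToMoment_eq_dualMoment_iff hM hMN hab]
    refine forall₂_congr fun l hl => ?_
    have hsum : ∑ p ∈ Finset.HasAntidiagonal.antidiagonal l,
        expCoeff (fun l => κa (2 * l) / 2) p.1 * expCoeff (fun l => κb (2 * l) / 2) p.2 =
        ((N : ℝ) / 4) ^ l * ∑ p ∈ Finset.HasAntidiagonal.antidiagonal l,
          rectCoeff M N a p.1 * rectCoeff M N b p.2 := by
      rw [Finset.mul_sum]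
      refine Finset.sum_congr rfl fun p hp => ?_
      rw [Finset.HasAntidiagonal.mem_antidiagonal] at hp
      rw [ha' p.1 (by omega), hb' p.2 (by omega), ← hp, pow_add]
      ring
    simp only [add_div]
    rw [expCoeff_add, hsum, mul_right_inj' (pow_ne_zero _ hN), eq_comm]
  constructor
  · rintro ⟨κa, κb, ha, hb, hc⟩
    exact (key κa κb ha hb).mp hc
  · intro h
    obtain ⟨κa, ha⟩ := exists_isQGammaCumulants hM hMN (dualMoment N a)
    obtain ⟨κb, hb⟩ := exists_isQGammaCumulants hM hMN (dualMoment N b)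
    exact ⟨κa, κb, ha, hb, (key κa κb ha hb).mpr h⟩

end RectDuality

theorem theorem6p1 (M N : ℕ) (hM : 1 ≤ M) (hMN : M ≤ N) (q γ : ℝ)
    (hγ : γ = -(M : ℝ)) (hq : q = (N : ℝ) / (M : ℝ)) :
    -- the first `M` even moments and the first `2M` cumulants determine each other
    (∀ m : ℕ → ℝ, ∃ κ : ℕ → ℝ, RectDuality.IsQGammaCumulants q γ M κ m ∧
      ∀ κ' : ℕ → ℝ, RectDuality.IsQGammaCumulants q γ M κ' m →
        ∀ l, 1 ≤ l → l ≤ 2 * M → κ' l = κ l) ∧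
    -- the q-γ convolution is a binary operation on the first `M` even moments
    (∀ ma mb : ℕ → ℝ, ∃ mc : ℕ → ℝ, RectDuality.IsQGammaConv q γ M ma mb mc ∧
      ∀ mc' : ℕ → ℝ, RectDuality.IsQGammaConv q γ M ma mb mc' →
        ∀ k, 1 ≤ k → k ≤ M → mc' k = mc k) ∧
    -- the two moment-cumulant relations are the same
    (∀ (a : Fin M → ℝ) (κ : ℕ → ℝ), (∀ l, Odd l → κ l = 0) →
      ((∀ k, 1 ≤ k → k ≤ M →
          RectDuality.cumulantToMoment q γ κ k = RectDuality.dualMoment N a k) ↔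
        (∀ l, 1 ≤ l → l ≤ M →
          RectDuality.rectCumulant M N a l = 4 ^ l * (κ (2 * l) / 2) * γ ^ (l - 1)))) ∧
    -- the two convolutions are the same operation on the first `M` moments
    (∀ a b c : Fin M → ℝ,
      RectDuality.IsRectFiniteConv M N a b c ↔
        RectDuality.IsQGammaConv q γ M (RectDuality.dualMoment N a)
          (RectDuality.dualMoment N b) (RectDuality.dualMoment N c)) := by
  subst hγ hq
  have hM0 : M ≠ 0 := by omega
  have hγ : -(M : ℝ) ≠ 0 := neg_ne_zero.mpr (Nat.cast_ne_zero.mpr hM0)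
  refine ⟨fun m => ?_, fun ma mb => ?_, fun a κ hκ => ?_, fun a b c => ?_⟩
  · obtain ⟨κ, h⟩ := RectDuality.exists_isQGammaCumulants hM0 hMN m
    refine ⟨κ, h, fun κ' h' l h1 hl => ?_⟩
    rcases Nat.even_or_odd' l with ⟨j, rfl | rfl⟩
    · have := h.unique hM0 hMN h' j (by omega) (by omega)
      linarith
    · rw [h.1 _ (odd_two_mul_add_one j), h'.1 _ (odd_two_mul_add_one j)]
  · obtain ⟨κa, ha⟩ := RectDuality.exists_isQGammaCumulants hM0 hMN ma
    obtain ⟨κb, hb⟩ := RectDuality.exists_isQGammaCumulants hM0 hMN mb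
    have hab : ∀ l, Odd l → κa l + κb l = 0 := fun l hl => by rw [ha.1 l hl, hb.1 l hl, add_zero]
    -- The witness, fixed by the `rfl`, is the moment sequence of `κa + κb`.
    refine ⟨_, ⟨κa, κb, ha, hb, hab, fun _ _ _ => rfl⟩, ?_⟩
    rintro mc' ⟨κa', κb', ha', hb', hc'⟩ k h1 hk
    rw [← hc'.2 k h1 hk]
    refine RectDuality.cumulantToMoment_congr hγ hab hc'.1 (fun l h1 hl => ?_) k h1 hk
    rw [add_div, add_div, ha.unique hM0 hMN ha' l hl h1, hb.unique hM0 hMN hb' l hl h1]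
  · rw [RectDuality.cumulantToMoment_eq_dualMoment_iff hM0 hMN hκ,
      RectDuality.rectCumulant_eq_iff hM0]
  · rw [RectDuality.isRectFiniteConv_iff, RectDuality.isQGammaConv_dualMoment_iff hM0 hMN]
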